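/- Let $\Gamma$ be a (discrete) group. A \emph{normed $\Gamma$-module} is a real normed space with an action of $\Gamma$ by linear isometries. For a normed $\Gamma$-module $V$, let $H^\bullet_b(\Gamma;V)$ be the cohomology of the complex $\ell^\infty(\Gamma^0,V)\xrightarrow{\delta^0}\ell^\infty(\Gamma^1,V)\xrightarrow{\delta^1}\cdots$, where $\ell^\infty(\Gamma^k,V)$ is the space of bounded functions $\Gamma^k\to V$ and $$\delta^k(f)(\gamma_1,\dots,\gamma_{k+1})=\gamma_1\cdot f(\gamma_2,\dots,\gamma_{k+1})+\sum_{j=1}^{k}(-1)^j f(\gamma_1,\dots,\gamma_j\gamma_{j+1},\dots,\gamma_{k+1})+(-1)^{k+1}f(\gamma_1,\dots,\gamma_k).$$ For an integer $n\geq 1$ or $n=\infty$, the group $\Gamma$ is \emph{boundedly $n$-acyclic} if $H^i_b(\Gamma;\mathbb{R})=0$ for all integers $i$ with $1\leq i\leq n$, where $\mathbb{R}$ carries the trivial action. A \emph{dual normed $\Gamma$-module} is the space $\mathcal{B}(W,\mathbb{R})$ of bounded linear functionals on a normed $\Gamma$-module $W$, with the operator norm and the action $(\gamma\cdot f)(w)=f(\gamma^{-1}\cdot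 w)$. A normed $\Gamma$-module $V$ is \emph{relatively injective} if for all normed $\Gamma$-modules $A,B$, every bounded linear $\Gamma$-equivariant map $\iota\colon A\to B$ that admits a bounded linear (not necessarily equivariant) map $\sigma\colon B\to A$ with $\sigma\circ\iota=\mathrm{id}_A$ and $\|\sigma\|\leq 1$, and every bounded linear $\Gamma$-equivariant map $\alpha\colon A\to V$, there is a bounded linear $\Gamma$-equivariant map $\beta\colon B\to V$ with $\beta\circ\iota=\alpha$ and $\|\beta\|\leq\|\alpha\|$. \textbf{Corollary.} Let $n\geq 1$ be an integer or $n=\infty$. Let $\Gamma$ be a boundedly $n$-acyclic group, let $H\trianglelefteq\Gamma$ be a normal subgroup, and let $\varphi\colon\Gamma\to\Gamma/H$ be the quotient homomorphism. For a normed $\Gamma/H$-module $V$, let $\varphi^{-1}V$ denote $V$ with the $\Gamma$-action pulled back along $\varphi$. Then $H$ is boundedly $n$-acyclic if and only if $$H^i_b(\Gamma;\varphi^{-1}V)=0$$ for every relatively injective dual normed $\Gamma/H$-module $V$ and every integer $i$ with $1\leq i\leq n$. -/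

import Mathlib

universe u v

/-! Normed modules over a discrete group `Γ`: a real normed space `V` together with a homomorphism
`ρ : Γ →* (V ≃ₗᵢ[ℝ] V)`, i.e. a linear isometric action. The trivial module is `ρ = 1`; the
pullback `φ⁻¹V` along `φ : Γ →* K` is `ρ.comp φ`. -/

namespace BoundedCohomology

section Cochains

variable {Γ : Type u} [Group Γ] {V : Type v} [NormedAddCommGroup V] [NormedSpace ℝ V]

/-- The space `ℓ^∞(Γⁿ, V)` of bounded functions `Γⁿ → V`, with the supremum norm. -/
abbrev BoundedCochains (Γ : Type u) (V : Type v) [NormedAddCommGroup V] (n : ℕ) :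
    Type (max u v) :=
  lp (fun _ : Fin n → Γ => V) ⊤

/-- The inhomogeneous coboundary on arbitrary functions `Γⁿ → V`:
`(δf)(γ₁, …, γₙ₊₁) = γ₁ • f(γ₂, …, γₙ₊₁) + ∑_{1 ≤ j ≤ n} (-1)^j f(γ₁, …, γⱼγⱼ₊₁, …, γₙ₊₁)
  + (-1)^{n+1} f(γ₁, …, γₙ)`.
The index `j : Fin (n + 1)` below is the mathematical index minus one, and `Fin.contractNth` at
the last index drops the last entry. -/
def coboundaryFun (ρ : Γ →* (V ≃ₗᵢ[ℝ] V)) (n : ℕ) :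
    ((Fin n → Γ) → V) →ₗ[ℝ] ((Fin (n + 1) → Γ) → V) where
  toFun f g := ρ (g 0) (f fun i => g i.succ) +
    ∑ j : Fin (n + 1), (-1 : ℝ) ^ ((j : ℕ) + 1) • f (Fin.contractNth j (· * ·) g)
  map_add' f f' := by
    funext g
    simp only [Pi.add_apply, map_add, smul_add, Finset.sum_add_distrib]
    abel
  map_smul' c f := by
    funext g
    simp only [Pi.smul_apply, map_smul, RingHom.id_apply, smul_add, Finset.smul_sum]
    congr 1
    exact Finset.sum_congr rfl fun j _ => smul_comm _ _ _

theorem coboundaryFun_apply (ρ : Γ →* (V ≃ₗᵢ[ℝ] V)) (n : ℕ) (f : (Fin n → Γ) → V)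
    (g : Fin (n + 1) → Γ) :
    coboundaryFun ρ n f g = ρ (g 0) (f fun i => g i.succ) +
      ∑ j : Fin (n + 1), (-1 : ℝ) ^ ((j : ℕ) + 1) • f (Fin.contractNth j (· * ·) g) := rfl

theorem coboundaryFun_comp (ρ : Γ →* (V ≃ₗᵢ[ℝ] V)) (n : ℕ) (f : (Fin n → Γ) → V) :
    coboundaryFun ρ (n + 1) (coboundaryFun ρ n f) = 0 := by
  let r : Representation (ULift.{max u v} ℝ) (ULift.{v} Γ) (ULift.{u} V) :=
    { toFun := fun g =>
        { toFun := fun x => ⟨ρ g.down x.down⟩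
          map_add' := fun x y => by ext; simp
          map_smul' := fun c x => by
            ext
            exact (ρ g.down).map_smul c.down x.down }
      map_one' := by ext x; simp
      map_mul' := fun g h => by ext x; simp }
  have hd : ∀ (m : ℕ) (f : (Fin m → Γ) → V) (g : Fin (m + 1) → ULift.{v} Γ),
      (inhomogeneousCochains.d (Rep.of r) m).hom (fun g => ⟨f fun i => (g i).down⟩) g =
        ⟨coboundaryFun ρ m f fun i => (g i).down⟩ := by
    intro m f g
    rw [inhomogeneousCochains.d_hom_apply]
    have hc : ∀ j : Fin (m + 1), (fun i => (Fin.contractNth j (· * ·) g i).down) =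
        Fin.contractNth j (· * ·) fun i => (g i).down := by
      intro j
      funext i
      simp only [Fin.contractNth]
      split_ifs <;> rfl
    apply ULift.down_injective
    change ρ (g 0).down (f fun i => (g i.succ).down) +
      AddEquiv.ulift (∑ j : Fin (m + 1), (-1 : ULift.{max u v} ℝ) ^ ((j : ℕ) + 1) •
        (⟨f fun i => (Fin.contractNth j (· * ·) g i).down⟩ : ULift.{u} V)) = _
    rw [map_sum, coboundaryFun_apply]
    congr 1
    refine Finset.sum_congr rfl fun j _ => ?_
    rw [← hc j]
    rfl
  have h := groupCohomology.inhomogeneousCochains.d_comp_d n (Rep.of r)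
  funext g
  have h2 := congrArg (fun F => F.hom (fun g => (⟨f fun i => (g i).down⟩ : ULift.{u} V))
    (fun i => (⟨g i⟩ : ULift.{v} Γ))) h
  dsimp only at h2
  rw [ModuleCat.hom_comp, LinearMap.comp_apply] at h2
  rw [funext (hd n f), hd] at h2
  exact congrArg ULift.down h2

theorem coboundaryFun_memℓp (ρ : Γ →* (V ≃ₗᵢ[ℝ] V)) (n : ℕ) (f : BoundedCochains Γ V n) :
    Memℓp (coboundaryFun ρ n f) ⊤ := by
  refine memℓp_infty ⟨‖f‖ + ∑ _j : Fin (n + 1), ‖f‖, ?_⟩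
  rintro _ ⟨g, rfl⟩
  dsimp only
  rw [coboundaryFun_apply]
  refine (norm_add_le _ _).trans (add_le_add ?_ ?_)
  · rw [LinearIsometryEquiv.norm_map]
    exact lp.norm_apply_le_norm (by simp) f _
  · refine (norm_sum_le _ _).trans (Finset.sum_le_sum fun j _ => ?_)
    rw [norm_smul, norm_pow, norm_neg, norm_one, one_pow, one_mul]
    exact lp.norm_apply_le_norm (by simp) f _

/-- The coboundary `δⁿ : ℓ^∞(Γⁿ, V) → ℓ^∞(Γⁿ⁺¹, V)` of the bounded complex. -/
noncomputable def coboundary (ρ : Γ →* (V ≃ₗᵢ[ℝ] V)) (n : ℕ) :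
    BoundedCochains Γ V n →ₗ[ℝ] BoundedCochains Γ V (n + 1) where
  toFun f := ⟨coboundaryFun ρ n f, coboundaryFun_memℓp ρ n f⟩
  map_add' f f' := Subtype.ext ((coboundaryFun ρ n).map_add f f')
  map_smul' c f := Subtype.ext ((coboundaryFun ρ n).map_smul c f)

theorem coboundary_apply (ρ : Γ →* (V ≃ₗᵢ[ℝ] V)) (n : ℕ) (f : BoundedCochains Γ V n)
    (g : Fin (n + 1) → Γ) :
    coboundary ρ n f g = ρ (g 0) (f fun i => g i.succ) +
      ∑ j : Fin (n + 1), (-1 : ℝ) ^ ((j : ℕ) + 1) • f (Fin.contractNth j (· * ·) g) := rfl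

theorem coboundary_comp (ρ : Γ →* (V ≃ₗᵢ[ℝ] V)) (n : ℕ) (f : BoundedCochains Γ V n) :
    coboundary ρ (n + 1) (coboundary ρ n f) = 0 :=
  Subtype.ext (coboundaryFun_comp ρ n f)

/-- The subspace of coboundaries in `ℓ^∞(Γⁿ, V)`: zero if `n = 0`, the image of `δⁿ⁻¹` if
`n ≥ 1`. -/
noncomputable def boundaries (ρ : Γ →* (V ≃ₗᵢ[ℝ] V)) :
    (n : ℕ) → Submodule ℝ (BoundedCochains Γ V n)
  | 0 => ⊥
  | n + 1 => LinearMap.range (coboundary ρ n)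

theorem boundaries_le_ker (ρ : Γ →* (V ≃ₗᵢ[ℝ] V)) (n : ℕ) :
    boundaries ρ n ≤ LinearMap.ker (coboundary ρ n) := by
  cases n with
  | zero => exact bot_le
  | succ n =>
    rintro _ ⟨f, rfl⟩
    exact coboundary_comp ρ n f

/-- Bounded cohomology `H^n_b(Γ; V) = ker δⁿ / im δⁿ⁻¹`. -/
abbrev Hb (ρ : Γ →* (V ≃ₗᵢ[ℝ] V)) (n : ℕ) : Type (max u v) :=
  LinearMap.ker (coboundary ρ n) ⧸ (boundaries ρ n).submoduleOf (LinearMap.ker (coboundary ρ n))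

end Cochains

/-- `Γ` is boundedly `n`-acyclic (`n = ⊤` allowed): `H^i_b(Γ; ℝ) = 0` for `1 ≤ i ≤ n`, where `ℝ`
carries the trivial action. -/
def BoundedlyAcyclic (Γ : Type u) [Group Γ] (n : ℕ∞) : Prop :=
  ∀ i : ℕ, 1 ≤ i → (i : ℕ∞) ≤ n → Subsingleton (Hb (1 : Γ →* (ℝ ≃ₗᵢ[ℝ] ℝ)) i)

/-- The dual normed module `B(W, ℝ)` of a normed module `W`, with the operator norm and the action
`(γ • f)(w) = f(γ⁻¹ • w)`. -/
noncomputable def dualAction {Γ : Type u} [Group Γ] {W : Type v} [NormedAddCommGroup W]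
    [NormedSpace ℝ W] (ρ : Γ →* (W ≃ₗᵢ[ℝ] W)) :
    Γ →* (StrongDual ℝ W ≃ₗᵢ[ℝ] StrongDual ℝ W) where
  toFun γ :=
    { toFun := fun f => f.comp ((ρ γ⁻¹ : W ≃ₗᵢ[ℝ] W).toContinuousLinearEquiv : W →L[ℝ] W)
      invFun := fun f => f.comp ((ρ γ : W ≃ₗᵢ[ℝ] W).toContinuousLinearEquiv : W →L[ℝ] W)
      map_add' := fun _ _ => rfl
      map_smul' := fun _ _ => rfl
      left_inv := fun f => by
        ext w
        change f (ρ γ⁻¹ (ρ γ w)) = f w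
        rw [map_inv]
        exact congrArg f ((ρ γ).symm_apply_apply w)
      right_inv := fun f => by
        ext w
        change f (ρ γ (ρ γ⁻¹ w)) = f w
        rw [map_inv]
        exact congrArg f ((ρ γ).apply_symm_apply w)
      norm_map' := fun f =>
        ContinuousLinearMap.opNorm_comp_linearIsometryEquiv f (ρ γ⁻¹) }
  map_one' := by ext f w; simp
  map_mul' γ γ' := by ext f w; simp

theorem dualAction_apply {Γ : Type u} [Group Γ] {W : Type v} [NormedAddCommGroup W]
    [NormedSpace ℝ W] (ρ : Γ →* (W ≃ₗᵢ[ℝ] W)) (γ : Γ) (f : StrongDual ℝ W) (w : W) :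
    dualAction ρ γ f w = f (ρ γ⁻¹ w) := rfl

section RelativelyInjective

variable {Γ : Type u} [Group Γ]

/-- Equivariance of a bounded linear map between normed modules. -/
def IsEquivariant {A B : Type*} [NormedAddCommGroup A] [NormedSpace ℝ A]
    [NormedAddCommGroup B] [NormedSpace ℝ B]
    (ρA : Γ →* (A ≃ₗᵢ[ℝ] A)) (ρB : Γ →* (B ≃ₗᵢ[ℝ] B)) (f : A →L[ℝ] B) : Prop :=
  ∀ (γ : Γ) (a : A), f (ρA γ a) = ρB γ (f a)

/-- A bounded linear map is strongly injective if it has a bounded linear (not necessarily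
equivariant) left inverse of norm at most one. -/
def IsStronglyInjective {A B : Type*} [NormedAddCommGroup A] [NormedSpace ℝ A]
    [NormedAddCommGroup B] [NormedSpace ℝ B] (ι : A →L[ℝ] B) : Prop :=
  ∃ σ : B →L[ℝ] A, ‖σ‖ ≤ 1 ∧ σ.comp ι = ContinuousLinearMap.id ℝ A

/-- A normed `Γ`-module `V` is relatively injective if every bounded equivariant map `α : A → V`
extends along every strongly injective bounded equivariant map `ι : A → B` of normed `Γ`-modules
to a bounded equivariant map `β : B → V` with `‖β‖ ≤ ‖α‖`. -/
def IsRelativelyInjective {V : Type u} [NormedAddCommGroup V] [NormedSpace ℝ V]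
    (ρ : Γ →* (V ≃ₗᵢ[ℝ] V)) : Prop :=
  ∀ (A B : Type u) [NormedAddCommGroup A] [NormedSpace ℝ A]
    [NormedAddCommGroup B] [NormedSpace ℝ B]
    (ρA : Γ →* (A ≃ₗᵢ[ℝ] A)) (ρB : Γ →* (B ≃ₗᵢ[ℝ] B)) (ι : A →L[ℝ] B) (α : A →L[ℝ] V),
    IsEquivariant ρA ρB ι → IsStronglyInjective ι → IsEquivariant ρA ρ α →
      ∃ β : B →L[ℝ] V, IsEquivariant ρB ρ β ∧ β.comp ι = α ∧ ‖β‖ ≤ ‖α‖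

end RelativelyInjective

end BoundedCohomology

/-! Write K = Γ/H. Both directions work with homogeneous cochains and an H-equivariant retraction r
: Γ → H.

If H is boundedly n-acyclic, its bounded cohomology also vanishes with coefficients in a dual space
carrying the trivial action (`subsingleton_Hb_strongDual`): the open mapping theorem and Hahn–Banach
give a bounded linear choice of primitives, applied to the real cocycles f(·)(w) for each w. Since H
acts trivially on φ⁻¹V, a Γ-equivariant cocycle is H-invariant and has an H-invariant primitive on Γ
(`exists_invariant_primitive`). Relative injectivity of V supplies an equivariant mean ℓ^∞(K, V) →
V, and averaging makes the primitive Γ-equivariant.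

Conversely, ℓ^∞(K), the dual of the finitely supported functions with the ℓ¹-norm, is relatively
injective. A Shapiro argument (`subsingleton_Hb_subgroup`) induces a real cocycle on H to an
ℓ^∞(K)-valued one on Γ; a primitive of it, restricted to H and evaluated at 1 ∈ K, is a primitive on
H. -/

namespace BoundedCohomology

/-! ### Prism operators. -/

section Prism

variable {X Y : Type*} {V : Type*} [AddCommGroup V]

/-- The prism operator
`(PF)(x₀, …, xₙ₋₁) = ∑ⱼ (-1)^j F(a x₀, …, a xⱼ, b xⱼ, …, b xₙ₋₁)`. -/
def prism (a b : X → Y) : (n : ℕ) → ((Fin (n + 1) → Y) → V) → (Fin n → X) → V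
  | 0, _, _ => 0
  | n + 1, F, z => F (Fin.cons (a (z 0)) (b ∘ z) : Fin (n + 2) → Y) -
      prism a b n (fun w => F (Fin.cons (a (z 0)) w : Fin (n + 2) → Y)) (Fin.tail z)

theorem prism_cons (a b : X → Y) (n : ℕ) (F : (Fin (n + 2) → Y) → V) (x : X) (y : Fin n → X) :
    prism a b (n + 1) F (Fin.cons x y : Fin (n + 1) → X) =
      F (Fin.cons (a x) (Fin.cons (b x) (b ∘ y) : Fin (n + 1) → Y) : Fin (n + 2) → Y) -
      prism a b n (fun w => F (Fin.cons (a x) w : Fin (n + 2) → Y)) y := by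
  rw [prism, Fin.cons_zero, Fin.tail_cons]
  congr 3
  funext i
  refine Fin.cases ?_ (fun i => ?_) i <;> simp

theorem prism_sub (a b : X → Y) (n : ℕ) (F F' : (Fin (n + 1) → Y) → V) (z : Fin n → X) :
    prism a b n (fun w => F w - F' w) z = prism a b n F z - prism a b n F' z := by
  induction n with
  | zero => simp [prism]
  | succ n ih => simp only [prism]; rw [ih]; abel

/-- Naturality of the prism; with left translations for `m` and `k` it yields invariance under a
subgroup. -/
theorem prism_comp {X' Y' : Type*} (a b : X → Y) (a' b' : X' → Y') (m : X → X') (k : Y → Y')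
    (ha : ∀ x, a' (m x) = k (a x)) (hb : ∀ x, b' (m x) = k (b x)) (n : ℕ)
    (F : (Fin (n + 1) → Y') → V) (z : Fin n → X) :
    prism a' b' n F (m ∘ z) = prism a b n (fun w => F (k ∘ w)) z := by
  induction n with
  | zero => rfl
  | succ n ih =>
    have hc : ∀ (l : ℕ) (y : Y) (w : Fin l → Y),
        k ∘ (Fin.cons y w : Fin (l + 1) → Y) = Fin.cons (k y) (k ∘ w) := by
      intro l y w
      funext i
      refine Fin.cases ?_ (fun i => ?_) i <;> simp
    have hb' : b' ∘ m ∘ z = k ∘ b ∘ z := funext fun i => hb (z i)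
    simp only [prism, hc]
    rw [hb', Function.comp_apply, ha]
    exact congrArg _ (ih (fun w => F (Fin.cons (k (a (z 0))) w : Fin (n + 2) → Y')) (Fin.tail z))

theorem prism_zero (a b : X → Y) (n : ℕ) (z : Fin n → X) :
    prism a b n (fun _ => (0 : V)) z = 0 := by
  induction n with
  | zero => rfl
  | succ n ih => rw [prism, ih, sub_zero]

end Prism

/-! ### The homogeneous differential and the prism homotopy. -/

section Homogeneous

variable {X Y : Type*} {V : Type*} [AddCommGroup V] [Module ℝ V]

/-- The homogeneous differential `(δF)(x₀, …, xₙ) = ∑ᵢ (-1)^i F(x₀, …, x̂ᵢ, …, xₙ)`. -/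
def homDiff (n : ℕ) (F : (Fin n → X) → V) (z : Fin (n + 1) → X) : V :=
  ∑ i : Fin (n + 1), (-1 : ℝ) ^ (i : ℕ) • F (z ∘ i.succAbove)

theorem homDiff_comp (m : X → Y) (n : ℕ) (F : (Fin n → Y) → V) (z : Fin (n + 1) → X) :
    homDiff n (fun w => F (m ∘ w)) z = homDiff n F (m ∘ z) := rfl

theorem homDiff_sub (n : ℕ) (F F' : (Fin n → X) → V) (z : Fin (n + 1) → X) :
    homDiff n (fun w => F w - F' w) z = homDiff n F z - homDiff n F' z := by
  simp [homDiff, smul_sub]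

theorem map_homDiff {V' : Type*} [AddCommGroup V'] [Module ℝ V'] (L : V →ₗ[ℝ] V') (n : ℕ)
    (F : (Fin n → X) → V) (z : Fin (n + 1) → X) :
    L (homDiff n F z) = homDiff n (fun w => L (F w)) z := by
  simp [homDiff]

theorem homDiff_cons (n : ℕ) (F : (Fin (n + 1) → X) → V) (x : X) (y : Fin (n + 1) → X) :
    homDiff (n + 1) F (Fin.cons x y : Fin (n + 2) → X) =
      F y - homDiff n (fun w => F (Fin.cons x w : Fin (n + 1) → X)) y := by
  rw [homDiff, Fin.sum_univ_succ, homDiff, sub_eq_add_neg, ← Finset.sum_neg_distrib]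
  congr 1
  · simp [Fin.succAbove_zero]
  · refine Finset.sum_congr rfl fun i _ => ?_
    rw [Fin.cons_comp_succ_succAbove, Fin.val_succ, pow_succ, mul_neg_one, neg_smul]
    rfl

theorem homDiff_one (F : (Fin 1 → X) → V) (z : Fin 2 → X) :
    homDiff 1 F z = F (fun _ => z 1) - F (fun _ => z 0) := by
  rw [homDiff, Fin.sum_univ_two, sub_eq_add_neg]
  congr 1
  · simp only [Fin.val_zero, pow_zero, one_smul]
    congr 1; funext i; fin_cases i; rfl
  · simp only [Fin.val_one, pow_one, neg_smul, one_smul]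
    congr 2; funext i; fin_cases i; rfl

/-- Induction on the number of vertices: splitting off the first vertex of both the differential and
the prism leaves the same identity for F with `a x` frozen in its first slot; the remaining terms
cancel. It shows that pulling back along `a` or `b` differs by a coboundary on cocycles. -/
theorem prism_homotopy (a b : X → Y) (n : ℕ) (F : (Fin (n + 1) → Y) → V) (z : Fin (n + 1) → X) :
    prism a b (n + 1) (homDiff (n + 1) F) z + homDiff n (prism a b n F) z =
      F (b ∘ z) - F (a ∘ z) := by
  induction n with
  | zero =>
    have h0 : homDiff 0 (prism a b 0 F) z = 0 := by simp [homDiff, prism]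
    rw [h0, prism, prism, homDiff_one, add_zero, sub_zero]
    congr 2 <;> funext i <;> fin_cases i <;> rfl
  | succ n ih =>
    refine Fin.consCases (fun x y => ?_) z
    have hb : b ∘ (Fin.cons x y : Fin (n + 2) → X) = Fin.cons (b x) (b ∘ y) := by
      funext i
      refine Fin.cases ?_ (fun i => ?_) i <;> simp
    have ha : a ∘ (Fin.cons x y : Fin (n + 2) → X) = Fin.cons (a x) (a ∘ y) := by
      funext i
      refine Fin.cases ?_ (fun i => ?_) i <;> simp
    rw [prism_cons, homDiff_cons n (prism a b (n + 1) F), ha, hb]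
    simp only [homDiff_cons, prism_cons]
    rw [prism_sub, homDiff_sub]
    have h := ih (fun w => F (Fin.cons (a x) w : Fin (n + 2) → Y)) y
    have h2 := homDiff_comp b n (fun w => F (Fin.cons (a x) (Fin.cons (b x) w : Fin (n + 1) → Y) :
      Fin (n + 2) → Y)) y
    rw [h2]
    rw [← sub_eq_zero] at h ⊢
    rw [← h]
    abel

end Homogeneous

theorem norm_prism_le {X Y V : Type*} [NormedAddCommGroup V] [NormedSpace ℝ V] (a b : X → Y)
    (n : ℕ) (F : (Fin (n + 1) → Y) → V) (C : ℝ) (hF : ∀ z, ‖F z‖ ≤ C) (z : Fin n → X) :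
    ‖prism a b n F z‖ ≤ n * C := by
  induction n with
  | zero => simp [prism]
  | succ n ih =>
    rw [prism]
    refine (norm_sub_le _ _).trans ?_
    have := add_le_add (hF (Fin.cons (a (z 0)) (b ∘ z)))
      (ih (fun w => F (Fin.cons (a (z 0)) w : Fin (n + 2) → Y)) (fun w => hF _) (Fin.tail z))
    refine this.trans (le_of_eq ?_)
    push_cast
    ring

theorem exists_bound_of_memℓp {ι V : Type*} [NormedAddCommGroup V] {f : ι → V} (h : Memℓp f ⊤) : ∃ C, ∀ z, ‖f z‖ ≤ C := by
  obtain ⟨C, hC⟩ := memℓp_infty_iff.1 h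
  exact ⟨C, fun z => hC ⟨z, rfl⟩⟩

theorem memℓp_of_exists_bound {ι V : Type*} [NormedAddCommGroup V] {f : ι → V} (h : ∃ C, ∀ z, ‖f z‖ ≤ C) : Memℓp f ⊤ := by
  obtain ⟨C, hC⟩ := h
  exact memℓp_infty ⟨C, by rintro _ ⟨z, rfl⟩; exact hC z⟩

/-! ### Homogeneous versus inhomogeneous cochains. -/

section Comparison

variable {Γ : Type u} [Group Γ] {V : Type v} [NormedAddCommGroup V] [NormedSpace ℝ V]

theorem subsingleton_Hb_succ_iff (ρ : Γ →* (V ≃ₗᵢ[ℝ] V)) (n : ℕ) :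
    Subsingleton (Hb ρ (n + 1)) ↔ ∀ f : BoundedCochains Γ V (n + 1),
      coboundary ρ (n + 1) f = 0 → ∃ g, coboundary ρ n g = f := by
  rw [Submodule.Quotient.subsingleton_iff, Submodule.submoduleOf_eq_top]
  rfl

/-- The vertices are 1, g₀, g₀g₁, …. Deleting the first leaves the g₀-translate of the partial
products of the tail, which equivariance turns into the action term; deleting a later vertex
multiplies two neighbouring entries or drops the last one. -/
theorem coboundaryFun_homogeneous (ρ : Γ →* (V ≃ₗᵢ[ℝ] V)) (n : ℕ) (F : (Fin (n + 1) → Γ) → V)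
    (hF : ∀ (γ : Γ) (z : Fin (n + 1) → Γ), F (γ • z) = ρ γ (F z)) (g : Fin (n + 1) → Γ) :
    coboundaryFun ρ n (fun g => F (Fin.partialProd g)) g =
      homDiff (n + 1) F (Fin.partialProd g) := by
  rw [coboundaryFun_apply, homDiff, Fin.sum_univ_succ (n := n + 1)]
  congr 1
  · rw [← hF, Fin.val_zero, pow_zero, one_smul]
    congr 1
    funext i
    exact (Fin.partialProd_succ' g i).symm
  · refine Finset.sum_congr rfl fun j _ => ?_
    rw [Fin.partialProd_contractNth]
    rfl

/-- Homogeneous cochain attached to an inhomogeneous one. -/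
def homogenize (ρ : Γ →* (V ≃ₗᵢ[ℝ] V)) (n : ℕ) (f : (Fin n → Γ) → V) (z : Fin (n + 1) → Γ) : V :=
  ρ (z 0) (f fun i => (z i.castSucc)⁻¹ * z i.succ)

theorem homogenize_smul (ρ : Γ →* (V ≃ₗᵢ[ℝ] V)) (n : ℕ) (f : (Fin n → Γ) → V) (γ : Γ)
    (z : Fin (n + 1) → Γ) : homogenize ρ n f (γ • z) = ρ γ (homogenize ρ n f z) := by
  simp [homogenize, mul_assoc]

theorem homogenize_partialProd (ρ : Γ →* (V ≃ₗᵢ[ℝ] V)) (n : ℕ) (f : (Fin n → Γ) → V) :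
    (fun g => homogenize ρ n f (Fin.partialProd g)) = f := by
  funext g
  simp [homogenize, Fin.partialProd_right_inv]

/-- Every tuple is a translate of one starting at 1, and those are the partial products. -/
theorem equivariant_ext (ρ : Γ →* (V ≃ₗᵢ[ℝ] V)) (n : ℕ) {F F' : (Fin (n + 1) → Γ) → V}
    (hF : ∀ (γ : Γ) (z : Fin (n + 1) → Γ), F (γ • z) = ρ γ (F z))
    (hF' : ∀ (γ : Γ) (z : Fin (n + 1) → Γ), F' (γ • z) = ρ γ (F' z))
    (h : ∀ g, F (Fin.partialProd g) = F' (Fin.partialProd g)) : F = F' := by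
  funext z
  rw [← Fin.partialProd_left_inv z, hF, hF', h]

theorem homDiff_equivariant (ρ : Γ →* (V ≃ₗᵢ[ℝ] V)) (n : ℕ) {F : (Fin n → Γ) → V}
    (hF : ∀ (γ : Γ) (z : Fin n → Γ), F (γ • z) = ρ γ (F z)) (γ : Γ) (z : Fin (n + 1) → Γ) :
    homDiff n F (γ • z) = ρ γ (homDiff n F z) := by
  have := map_homDiff ((ρ γ).toLinearEquiv : V →ₗ[ℝ] V) n F z
  refine Eq.trans ?_ this.symm
  exact Finset.sum_congr rfl fun i _ => congrArg _ (hF γ _)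

/-- Bounded cohomology in positive degrees vanishes if and only if bounded equivariant homogeneous
cocycles are coboundaries of such cochains. -/
theorem subsingleton_Hb_succ_iff_homogeneous (ρ : Γ →* (V ≃ₗᵢ[ℝ] V)) (n : ℕ) :
    Subsingleton (Hb ρ (n + 1)) ↔ ∀ F : (Fin (n + 2) → Γ) → V, (∃ C, ∀ z, ‖F z‖ ≤ C) →
      (∀ (γ : Γ) (z : Fin (n + 2) → Γ), F (γ • z) = ρ γ (F z)) → homDiff (n + 2) F = 0 →
      ∃ G : (Fin (n + 1) → Γ) → V, (∃ C, ∀ z, ‖G z‖ ≤ C) ∧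
        (∀ (γ : Γ) (z : Fin (n + 1) → Γ), G (γ • z) = ρ γ (G z)) ∧ homDiff (n + 1) G = F := by
  rw [subsingleton_Hb_succ_iff]
  constructor
  · rintro h F ⟨C, hC⟩ hF hδ
    obtain ⟨g, hg⟩ := h ⟨fun g => F (Fin.partialProd g), memℓp_of_exists_bound ⟨C, fun z => hC _⟩⟩
      (Subtype.ext (funext fun g =>
        (coboundaryFun_homogeneous ρ (n + 1) F hF g).trans (congrFun hδ _)))
    obtain ⟨D, hD⟩ := exists_bound_of_memℓp g.2
    refine ⟨homogenize ρ n g, ⟨D, fun z => ?_⟩, homogenize_smul ρ n g, ?_⟩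
    · rw [homogenize, LinearIsometryEquiv.norm_map]
      exact hD _
    · refine equivariant_ext ρ (n + 1) (homDiff_equivariant ρ _ (homogenize_smul ρ n g)) hF
        fun w => ?_
      rw [← coboundaryFun_homogeneous ρ n _ (homogenize_smul ρ n g), homogenize_partialProd]
      exact congrFun (congrArg Subtype.val hg) w
  · intro h f hf
    obtain ⟨C, hC⟩ := exists_bound_of_memℓp f.2
    obtain ⟨G, ⟨D, hD⟩, hG, hGf⟩ := h (homogenize ρ (n + 1) f)
      ⟨C, fun z => by rw [homogenize, LinearIsometryEquiv.norm_map]; exact hC _⟩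
      (homogenize_smul ρ _ f) (by
        refine equivariant_ext ρ (n + 2) (homDiff_equivariant ρ _ (homogenize_smul ρ _ f))
          (fun γ z => by simp) fun w => ?_
        rw [← coboundaryFun_homogeneous ρ (n + 1) _ (homogenize_smul ρ _ f),
          homogenize_partialProd]
        exact congrFun (congrArg Subtype.val hf) w)
    refine ⟨⟨fun g => G (Fin.partialProd g), memℓp_of_exists_bound ⟨D, fun z => hD _⟩⟩,
      Subtype.ext (funext fun w => ?_)⟩
    refine (coboundaryFun_homogeneous ρ n G hG w).trans ?_
    rw [hGf]
    exact congrFun (homogenize_partialProd ρ (n + 1) f) w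

end Comparison

end BoundedCohomology

/-! ### From real coefficients to trivial dual coefficients. -/

namespace BoundedCohomology

/-- The space of bounded real functions is injective among normed spaces. -/
theorem exists_extension_boundedCochains {Γ : Type u} {E : Type*} [NormedAddCommGroup E] [NormedSpace ℝ E]
    (p : Submodule ℝ E) (n : ℕ) (t : p →L[ℝ] BoundedCochains Γ ℝ n) :
    ∃ T : E →L[ℝ] BoundedCochains Γ ℝ n, ∀ x : p, T x = t x := by
  have hb : ∀ (g : Fin n → Γ) (x : p), ‖t x g‖ ≤ ‖t‖ * ‖x‖ := fun g x =>
    (lp.norm_apply_le_norm (by simp) (t x) g).trans (t.le_opNorm x)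
  let ev : (Fin n → Γ) → StrongDual ℝ p := fun g =>
    LinearMap.mkContinuous
      { toFun := fun x => t x g
        map_add' := fun x y => by simp
        map_smul' := fun c x => by simp } ‖t‖ (hb g)
  have hev : ∀ g, ‖ev g‖ ≤ ‖t‖ := fun g =>
    ContinuousLinearMap.opNorm_le_bound _ (norm_nonneg t) (hb g)
  -- Hahn–Banach in each coordinate; preserving norms keeps the bound `‖t‖` uniform in `g`.
  choose T hT hTn using fun g => exists_extension_norm_eq p (ev g)
  have hTb : ∀ (x : E) (g : Fin n → Γ), ‖T g x‖ ≤ ‖t‖ * ‖x‖ := fun x g =>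
    (T g).le_of_opNorm_le ((hTn g).le.trans (hev g)) x
  refine ⟨LinearMap.mkContinuous
    { toFun := fun x => ⟨fun g => T g x, memℓp_of_exists_bound ⟨_, hTb x⟩⟩
      map_add' := fun x y => Subtype.ext (funext fun g => (T g).map_add x y)
      map_smul' := fun c x => Subtype.ext (funext fun g => (T g).map_smul c x) } ‖t‖
    fun x => lp.norm_le_of_forall_le (by positivity) (hTb x), fun x => ?_⟩
  exact Subtype.ext (funext fun g => hT g x)

section DualCoefficients

variable {Γ : Type u} [Group Γ]

theorem coboundary_one_zero {V : Type v} [NormedAddCommGroup V] [NormedSpace ℝ V]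
    (f : BoundedCochains Γ V 0) : coboundary (1 : Γ →* (V ≃ₗᵢ[ℝ] V)) 0 f = 0 := by
  refine Subtype.ext (funext fun g => ?_)
  refine (coboundary_apply _ 0 f g).trans ?_
  rw [Fin.sum_univ_one]
  have : Fin.contractNth 0 (· * ·) g = fun i : Fin 0 => g i.succ := Subsingleton.elim _ _
  rw [this]
  simp

theorem norm_coboundary_le {V : Type v} [NormedAddCommGroup V] [NormedSpace ℝ V]
    (ρ : Γ →* (V ≃ₗᵢ[ℝ] V)) (n : ℕ) (f : BoundedCochains Γ V n) :
    ‖coboundary ρ n f‖ ≤ (n + 2) * ‖f‖ := by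
  refine lp.norm_le_of_forall_le (by positivity) fun g => ?_
  rw [coboundary_apply]
  have h1 : ‖ρ (g 0) (f fun i => g i.succ)‖ ≤ ‖f‖ := by
    rw [LinearIsometryEquiv.norm_map]
    exact lp.norm_apply_le_norm (by simp) f _
  have h2 : ‖∑ j : Fin (n + 1), (-1 : ℝ) ^ ((j : ℕ) + 1) • f (Fin.contractNth j (· * ·) g)‖ ≤
      ∑ _j : Fin (n + 1), ‖f‖ := by
    refine (norm_sum_le _ _).trans (Finset.sum_le_sum fun j _ => ?_)
    rw [norm_smul, norm_pow, norm_neg, norm_one, one_pow, one_mul]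
    exact lp.norm_apply_le_norm (by simp) f _
  refine (norm_add_le_of_le h1 h2).trans (le_of_eq ?_)
  simp
  ring

/-- The coboundary as a bounded operator. -/
noncomputable def coboundaryL {V : Type v} [NormedAddCommGroup V] [NormedSpace ℝ V]
    (ρ : Γ →* (V ≃ₗᵢ[ℝ] V)) (n : ℕ) : BoundedCochains Γ V n →L[ℝ] BoundedCochains Γ V (n + 1) :=
  (coboundary ρ n).mkContinuous (n + 2) (norm_coboundary_le ρ n)

/-- If the cocycles in degree `n` are complemented and every cocycle in degree `n + 1` is a
coboundary, then the coboundary has a bounded linear section over the cocycles. -/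
theorem exists_section_of_projection (n : ℕ)
    (p : BoundedCochains Γ ℝ n →L[ℝ] BoundedCochains Γ ℝ n)
    (hp : ∀ c, coboundary (1 : Γ →* (ℝ ≃ₗᵢ[ℝ] ℝ)) n (p c) = 0)
    (hpz : ∀ z, coboundary (1 : Γ →* (ℝ ≃ₗᵢ[ℝ] ℝ)) n z = 0 → p z = z)
    (h : Subsingleton (Hb (1 : Γ →* (ℝ ≃ₗᵢ[ℝ] ℝ)) (n + 1))) :
    ∃ s : BoundedCochains Γ ℝ (n + 1) →L[ℝ] BoundedCochains Γ ℝ n,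
      ∀ z, coboundary (1 : Γ →* (ℝ ≃ₗᵢ[ℝ] ℝ)) (n + 1) z = 0 →
        coboundary (1 : Γ →* (ℝ ≃ₗᵢ[ℝ] ℝ)) n (s z) = z := by
  rw [subsingleton_Hb_succ_iff] at h
  let d := coboundaryL (1 : Γ →* (ℝ ≃ₗᵢ[ℝ] ℝ)) n
  let d' := coboundaryL (1 : Γ →* (ℝ ≃ₗᵢ[ℝ] ℝ)) (n + 1)
  let K : Submodule ℝ (BoundedCochains Γ ℝ n) := LinearMap.ker p.toLinearMap
  let Z : Submodule ℝ (BoundedCochains Γ ℝ (n + 1)) := LinearMap.ker d'.toLinearMap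
  have : CompleteSpace K := p.isClosed_ker.completeSpace_coe
  have : CompleteSpace Z := d'.isClosed_ker.completeSpace_coe
  -- ker p is a closed complement of the cocycles, so δ maps it bijectively onto the next cocycles
  -- Z. Both spaces are Banach, hence the inverse is bounded.
  let e : K →L[ℝ] Z := (d.comp K.subtypeL).codRestrict Z fun x => coboundary_comp _ n x.1
  have hinj : Function.Injective e := by
    refine (injective_iff_map_eq_zero e).2 fun x hx => Subtype.ext ?_
    have h1 : coboundary (1 : Γ →* (ℝ ≃ₗᵢ[ℝ] ℝ)) n x.1 = 0 := congrArg Subtype.val hx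
    rw [← hpz x.1 h1]
    exact x.2
  have hsurj : Function.Surjective e := by
    rintro ⟨z, hz⟩
    obtain ⟨g, hg⟩ := h z hz
    refine ⟨⟨g - p g, ?_⟩, Subtype.ext ?_⟩
    · change p (g - p g) = 0
      rw [map_sub, hpz _ (hp g), sub_self]
    · change coboundary _ n (g - p g) = z
      rw [map_sub, hp, hg, sub_zero]
  let E := ContinuousLinearEquiv.ofBijective e (LinearMap.ker_eq_bot.2 hinj)
    (LinearMap.range_eq_top.2 hsurj)
  -- The section is extended off Z so that δ ∘ s can serve as the projection one degree higher.
  obtain ⟨s, hs⟩ := exists_extension_boundedCochains Z n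
    (K.subtypeL.comp (E.symm : Z →L[ℝ] K))
  refine ⟨s, fun z hz => ?_⟩
  have := hs ⟨z, hz⟩
  change s z = _ at this
  rw [this]
  exact congrArg Subtype.val (ContinuousLinearEquiv.ofBijective_apply_symm_apply e
    (LinearMap.ker_eq_bot.2 hinj) (LinearMap.range_eq_top.2 hsurj) ⟨z, hz⟩)

theorem exists_bounded_section (n : ℕ)
    (h : ∀ i ≤ n, Subsingleton (Hb (1 : Γ →* (ℝ ≃ₗᵢ[ℝ] ℝ)) (i + 1))) :
    ∃ s : BoundedCochains Γ ℝ (n + 1) →L[ℝ] BoundedCochains Γ ℝ n,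
      ∀ z, coboundary (1 : Γ →* (ℝ ≃ₗᵢ[ℝ] ℝ)) (n + 1) z = 0 →
        coboundary (1 : Γ →* (ℝ ≃ₗᵢ[ℝ] ℝ)) n (s z) = z := by
  induction n with
  | zero =>
    -- With trivial action δ⁰ = 0, so every 0-cochain is a cocycle and the identity is the
    -- projection.
    exact exists_section_of_projection 0 (ContinuousLinearMap.id ℝ _) coboundary_one_zero
      (fun _ _ => rfl) (h 0 le_rfl)
  | succ n ih =>
    obtain ⟨s, hs⟩ := ih fun i hi => h i (hi.trans n.le_succ)
    exact exists_section_of_projection (n + 1) ((coboundaryL 1 n).comp s)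
      (fun c => coboundary_comp _ n (s c)) hs (h (n + 1) le_rfl)

theorem subsingleton_Hb_strongDual {W : Type v} [NormedAddCommGroup W] [NormedSpace ℝ W] (n : ℕ)
    (h : ∀ i ≤ n, Subsingleton (Hb (1 : Γ →* (ℝ ≃ₗᵢ[ℝ] ℝ)) (i + 1))) :
    Subsingleton (Hb (1 : Γ →* (StrongDual ℝ W ≃ₗᵢ[ℝ] StrongDual ℝ W)) (n + 1)) := by
  obtain ⟨s, hs⟩ := exists_bounded_section n h
  rw [subsingleton_Hb_succ_iff]
  intro f hf
  have hbd : ∀ (w : W) (g : Fin (n + 1) → Γ), ‖f g w‖ ≤ ‖f‖ * ‖w‖ := fun w g =>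
    (f g).le_of_opNorm_le (lp.norm_apply_le_norm (by simp) f g) w
  -- The cocycle f transposed: an operator from W to real cocycles. Composing with s and transposing
  -- back gives the primitive `G`.
  let ev : W →ₗ[ℝ] BoundedCochains Γ ℝ (n + 1) :=
    { toFun := fun w => ⟨fun g => f g w, memℓp_of_exists_bound ⟨_, hbd w⟩⟩
      map_add' := fun x y => Subtype.ext (funext fun g => (f g).map_add x y)
      map_smul' := fun c x => Subtype.ext (funext fun g => (f g).map_smul c x) }
  have hev : ∀ w, ‖ev w‖ ≤ ‖f‖ * ‖w‖ := fun w =>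
    lp.norm_le_of_forall_le (by positivity) (hbd w)
  have hevz : ∀ w, coboundary (1 : Γ →* (ℝ ≃ₗᵢ[ℝ] ℝ)) (n + 1) (ev w) = 0 := by
    intro w
    refine Subtype.ext (funext fun g => ?_)
    have h1 := congrArg (fun L : StrongDual ℝ W => L w) (congrFun (congrArg Subtype.val hf) g)
    refine Eq.trans ?_ h1
    refine (coboundary_apply _ _ _ _).trans ?_
    refine Eq.trans ?_ (congrArg (fun L : StrongDual ℝ W => L w) (coboundary_apply _ _ f g)).symm
    simp [ev]
  have hsb : ∀ (g : Fin n → Γ) (w : W), ‖s (ev w) g‖ ≤ ‖s‖ * ‖f‖ * ‖w‖ := fun g w => by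
    refine (lp.norm_apply_le_norm (by simp) (s (ev w)) g).trans ((s.le_opNorm _).trans ?_)
    rw [mul_assoc]
    exact mul_le_mul_of_nonneg_left (hev w) (norm_nonneg _)
  let G : (Fin n → Γ) → StrongDual ℝ W := fun g => LinearMap.mkContinuous
    { toFun := fun w => s (ev w) g
      map_add' := fun x y => by simp
      map_smul' := fun c x => by simp } (‖s‖ * ‖f‖) (hsb g)
  refine ⟨⟨G, memℓp_of_exists_bound ⟨‖s‖ * ‖f‖, fun g =>
    LinearMap.mkContinuous_norm_le _ (by positivity) _⟩⟩, Subtype.ext (funext fun g => ?_)⟩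
  refine ContinuousLinearMap.ext fun w => ?_
  have h1 := congrFun (congrArg Subtype.val (hs (ev w) (hevz w))) g
  refine Eq.trans ?_ h1
  refine Eq.trans (congrArg (fun L : StrongDual ℝ W => L w) (coboundary_apply _ _ _ g)) ?_
  refine Eq.trans ?_ (coboundary_apply _ _ _ _).symm
  simp [G]

end DualCoefficients

end BoundedCohomology

namespace BoundedCohomology

/-! ### Retraction onto a normal subgroup and invariant primitives. -/

section Subgroups

variable {Γ : Type u} [Group Γ]

/-- There is an equivariant retraction of a group onto a normal subgroup. -/
theorem exists_equivariant_retraction (H : Subgroup Γ) [H.Normal] :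
    ∃ r : Γ → H, (∀ (h : H) (g : Γ), r (h * g) = h * r g) ∧ ∀ h : H, r h = h := by
  have hmem : ∀ g : Γ, g * ((g : Γ ⧸ H).out)⁻¹ ∈ H := fun g => by
    rw [← QuotientGroup.eq_one_iff, QuotientGroup.mk_mul, QuotientGroup.mk_inv,
      QuotientGroup.out_eq', mul_inv_cancel]
  let r : Γ → H := fun g => ⟨g * ((g : Γ ⧸ H).out)⁻¹, hmem g⟩
  have hr : ∀ (h : H) (g : Γ), r (h * g) = h * r g := fun h g => by
    apply Subtype.ext
    have : (((h : Γ) * g : Γ) : Γ ⧸ H) = g := by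
      rw [QuotientGroup.mk_mul, (QuotientGroup.eq_one_iff _).2 h.2, one_mul]
    simp only [r, this, Subgroup.coe_mul, mul_assoc]
  -- The representative of the trivial coset may differ from 1; right translation by (r 1)⁻¹
  -- normalises r on H and preserves left equivariance.
  refine ⟨fun g => r (g * ((r 1)⁻¹ : H)), fun h g => ?_, fun h => ?_⟩
  · simp only [mul_assoc, hr]
  · have := hr (h * (r 1)⁻¹) 1
    simpa using this

/-- Makes constructions using `x.out` independent of the coset representative. -/
theorem apply_smul_eq_of_mk_eq {H : Subgroup Γ} [H.Normal] {V : Type*} {n : ℕ}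
    {R : (Fin n → Γ) → V} (hR : ∀ h ∈ H, ∀ z, R (h • z) = R z) {g g' : Γ}
    (h : (g : Γ ⧸ H) = g') (z : Fin n → Γ) : R (g • z) = R (g' • z) := by
  have hm : g * g'⁻¹ ∈ H := by
    rw [← QuotientGroup.eq_one_iff, QuotientGroup.mk_mul, QuotientGroup.mk_inv, h, mul_inv_cancel]
  rw [← hR _ hm (g' • z), smul_smul, inv_mul_cancel_right]

/-- If a normal subgroup has vanishing bounded cohomology, then bounded cocycles on the ambient
group which are invariant under the subgroup have invariant bounded primitives. -/
theorem exists_invariant_primitive {V : Type v} [NormedAddCommGroup V] [NormedSpace ℝ V]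
    (H : Subgroup Γ) [H.Normal] (n : ℕ)
    (hH : Subsingleton (Hb (1 : H →* (V ≃ₗᵢ[ℝ] V)) (n + 1))) (F : (Fin (n + 2) → Γ) → V)
    (hb : ∃ C, ∀ z, ‖F z‖ ≤ C) (hF : ∀ h ∈ H, ∀ z, F (h • z) = F z) (hδ : homDiff (n + 2) F = 0) :
    ∃ G : (Fin (n + 1) → Γ) → V, (∃ C, ∀ z, ‖G z‖ ≤ C) ∧ (∀ h ∈ H, ∀ z, G (h • z) = G z) ∧
      homDiff (n + 1) G = F := by
  obtain ⟨C, hC⟩ := hb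
  obtain ⟨r, hr, -⟩ := exists_equivariant_retraction H
  obtain ⟨G, ⟨D, hD⟩, hG, hGF⟩ := (subsingleton_Hb_succ_iff_homogeneous _ n).1 hH
    (fun z => F (Subtype.val ∘ z)) ⟨C, fun z => hC _⟩ (fun h z => hF h h.2 _)
    (funext fun z => congrFun hδ (Subtype.val ∘ z))
  let a : Γ → Γ := fun g => r g
  -- Here δ(r*G) = r*F, while the homotopy between id and r gives δ(PF) = r*F − F; the difference is
  -- F.
  refine ⟨fun z => G (r ∘ z) - prism id a (n + 1) F z, ⟨D + (n + 1 : ℕ) * C, fun z => ?_⟩,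
    fun h hh z => ?_, funext fun z => ?_⟩
  · exact norm_sub_le_of_le (hD _) (norm_prism_le _ _ _ _ _ hC _)
  · have h1 : r ∘ (h • z) = (⟨h, hh⟩ : H) • (r ∘ z) := funext fun i => hr ⟨h, hh⟩ (z i)
    have h2 := prism_comp id a id a (fun g => h * g) (fun g => h * g) (fun _ => rfl)
      (fun g => congrArg Subtype.val (hr ⟨h, hh⟩ g)) (n + 1) F z
    have h3 : (fun w => F ((fun g => h * g) ∘ w)) = F := funext fun w => hF h hh w
    rw [h3] at h2
    refine congrArg₂ _ ?_ h2
    rw [h1, hG]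
    rfl
  · have h1 := prism_homotopy id a (n + 1) F z
    have h0 : homDiff (n + 2) F = fun _ => 0 := hδ
    rw [h0, prism_zero, zero_add] at h1
    rw [homDiff_sub, h1, homDiff_comp r (n + 1) G z, hGF]
    simp only [Function.id_comp]
    change F (a ∘ z) - (F (a ∘ z) - F z) = F z
    abel

end Subgroups

theorem memℓp_translate {K : Type u} [Group K] {V : Type v} [NormedAddCommGroup V] (k : K)
    (f : lp (fun _ : K => V) ⊤) : Memℓp (fun x => f (k⁻¹ * x)) ⊤ :=
  memℓp_of_exists_bound ⟨‖f‖, fun _ => lp.norm_apply_le_norm (by simp) f _⟩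

/-! ### Averaging over the quotient by relative injectivity. -/

section Averaging

variable {K : Type u} [Group K] {V : Type u} [NormedAddCommGroup V] [NormedSpace ℝ V]

variable (K V) in
/-- The action of `K` on bounded functions `K → V` by translation. -/
noncomputable def translation :
    K →* (lp (fun _ : K => V) ⊤ ≃ₗᵢ[ℝ] lp (fun _ : K => V) ⊤) where
  toFun k :=
    { toFun := fun f => ⟨fun x => f (k⁻¹ * x), memℓp_translate k f⟩
      invFun := fun f => ⟨fun x => f (k⁻¹⁻¹ * x), memℓp_translate k⁻¹ f⟩
      map_add' := fun _ _ => rfl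
      map_smul' := fun _ _ => rfl
      left_inv := fun f => Subtype.ext (funext fun x => congrArg f (by simp))
      right_inv := fun f => Subtype.ext (funext fun x => congrArg f (by simp))
      norm_map' := fun f => by
        change ‖(⟨fun x => f (k⁻¹ * x), memℓp_translate k f⟩ : lp (fun _ : K => V) ⊤)‖ = ‖f‖
        refine le_antisymm (lp.norm_le_of_forall_le (norm_nonneg f) fun x =>
          lp.norm_apply_le_norm (by simp) f _) (lp.norm_le_of_forall_le (norm_nonneg _) fun x => ?_)
        have := lp.norm_apply_le_norm (by simp)
          (⟨fun x => f (k⁻¹ * x), memℓp_translate k f⟩ : lp (fun _ : K => V) ⊤) (k * x)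
        simpa using this }
  map_one' := by
    ext f x
    change f (1⁻¹ * x) = f x
    simp
  map_mul' k l := by
    ext f x
    change f ((k * l)⁻¹ * x) = f (l⁻¹ * (k⁻¹ * x))
    simp [mul_assoc]

/-- A relatively injective module is an equivariant retract of the module of bounded functions. -/
theorem IsRelativelyInjective.exists_averaging {τ : K →* (V ≃ₗᵢ[ℝ] V)}
    (hτ : IsRelativelyInjective τ) :
    ∃ β : lp (fun _ : K => V) ⊤ →L[ℝ] V, (∀ k f, β (translation K V k f) = τ k (β f)) ∧
      ∀ (v : V) (f : lp (fun _ : K => V) ⊤), (∀ x, f x = τ x⁻¹ v) → β f = v := by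
  have hb : ∀ (v : V) (x : K), ‖τ x⁻¹ v‖ ≤ 1 * ‖v‖ := fun v x => by simp
  let ι : V →L[ℝ] lp (fun _ : K => V) ⊤ := LinearMap.mkContinuous
    { toFun := fun v => ⟨fun x => τ x⁻¹ v, memℓp_of_exists_bound ⟨_, hb v⟩⟩
      map_add' := fun v w => Subtype.ext (funext fun x => (τ x⁻¹).map_add v w)
      map_smul' := fun c v => Subtype.ext (funext fun x => (τ x⁻¹).map_smul c v) } 1
    fun v => lp.norm_le_of_forall_le (by positivity) (hb v)
  let σ : lp (fun _ : K => V) ⊤ →L[ℝ] V := LinearMap.mkContinuous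
    { toFun := fun f => f 1
      map_add' := fun _ _ => rfl
      map_smul' := fun _ _ => rfl } 1 fun f => by
        rw [one_mul]
        exact lp.norm_apply_le_norm (by simp) f 1
  -- The identity of V is extended along the orbit embedding v ↦ (x ↦ x⁻¹v), which evaluation at 1
  -- splits.
  obtain ⟨β, hβ, hβι, -⟩ := hτ V (lp (fun _ : K => V) ⊤) τ (translation K V) ι
    (ContinuousLinearMap.id ℝ V)
    (fun k v => Subtype.ext (funext fun x => by
      change τ x⁻¹ (τ k v) = τ (k⁻¹ * x)⁻¹ v
      rw [mul_inv_rev, inv_inv, map_mul]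
      rfl))
    ⟨σ, LinearMap.mkContinuous_norm_le _ zero_le_one _, ContinuousLinearMap.ext fun v => by
      change τ 1⁻¹ v = v
      simp⟩
    (fun _ _ => rfl)
  refine ⟨β, hβ, fun v f hf => ?_⟩
  have : f = ι v := Subtype.ext (funext hf)
  rw [this]
  exact congrArg (fun L : V →L[ℝ] V => L v) hβι

end Averaging

/-- Bounded cohomology of `Γ` with coefficients in a relatively injective `Γ ⧸ H`-module vanishes
where the bounded cohomology of `H` with the underlying trivial coefficients does. -/
theorem subsingleton_Hb_of_isRelativelyInjective {Γ : Type u} [Group Γ] (H : Subgroup Γ)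
    [H.Normal] {V : Type u} [NormedAddCommGroup V] [NormedSpace ℝ V]
    (τ : (Γ ⧸ H) →* (V ≃ₗᵢ[ℝ] V)) (hτ : IsRelativelyInjective τ) (n : ℕ)
    (hH : Subsingleton (Hb (1 : H →* (V ≃ₗᵢ[ℝ] V)) (n + 1))) :
    Subsingleton (Hb (τ.comp (QuotientGroup.mk' H)) (n + 1)) := by
  rw [subsingleton_Hb_succ_iff_homogeneous]
  intro F hb hF hδ
  obtain ⟨G, ⟨C, hC⟩, hG, hGF⟩ := exists_invariant_primitive H n hH F hb (fun h hh z => by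
    have h1 : (QuotientGroup.mk' H) h = 1 := (QuotientGroup.eq_one_iff h).2 hh
    rw [hF, MonoidHom.comp_apply, h1, map_one]
    rfl) hδ
  obtain ⟨β, hβ, hβv⟩ := hτ.exists_averaging
  -- H-invariance of G makes `u` Γ-equivariant, with Γ acting on functions through translation by
  -- the quotient.
  let u : (Fin (n + 1) → Γ) → lp (fun _ : Γ ⧸ H => V) ⊤ := fun z =>
    ⟨fun x => G (x.out⁻¹ • z), memℓp_of_exists_bound ⟨C, fun x => hC _⟩⟩
  have hu : ∀ (γ : Γ) (z : Fin (n + 1) → Γ), u (γ • z) = translation (Γ ⧸ H) V γ (u z) := fun γ z => by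
    refine Subtype.ext (funext fun x => ?_)
    change G (x.out⁻¹ • γ • z) = G (((γ : Γ ⧸ H)⁻¹ * x).out⁻¹ • z)
    rw [smul_smul]
    refine apply_smul_eq_of_mk_eq hG ?_ z
    simp
  refine ⟨fun z => β (u z), ⟨‖β‖ * C, fun z => ?_⟩, fun γ z => ?_, funext fun z => ?_⟩
  · refine (β.le_opNorm _).trans (mul_le_mul_of_nonneg_left ?_ (norm_nonneg _))
    exact lp.norm_le_of_forall_le ((norm_nonneg _).trans (hC z)) fun x => hC _
  · exact (congrArg β (hu γ z)).trans (hβ γ (u z))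
  · refine (map_homDiff β.toLinearMap (n + 1) u z).symm.trans ?_
    -- Coordinate x of δu(z) is F(x.out⁻¹z) = x⁻¹F(z), so δu(z) is the orbit function of F(z).
    refine hβv (F z) _ fun x => ?_
    let ev : lp (fun _ : Γ ⧸ H => V) ⊤ →ₗ[ℝ] V :=
      { toFun := fun f => f x, map_add' := fun _ _ => rfl, map_smul' := fun _ _ => rfl }
    refine (map_homDiff ev (n + 1) u z).trans ?_
    have h1 := congrFun hGF (x.out⁻¹ • z)
    rw [hF] at h1
    refine Eq.trans h1 ?_
    simp

/-! ### The ℓ¹-module of a group and relative injectivity of its dual. -/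

section SummableFunctions

/-- Finitely supported real functions, to be equipped with the `ℓ¹`-norm. -/
def FinsuppL1 (K : Type u) : Type u := K →₀ ℝ

variable {K : Type u}

noncomputable instance : AddCommGroup (FinsuppL1 K) := inferInstanceAs (AddCommGroup (K →₀ ℝ))

noncomputable instance : Module ℝ (FinsuppL1 K) := inferInstanceAs (Module ℝ (K →₀ ℝ))

noncomputable instance : Norm (FinsuppL1 K) := ⟨fun w => Finsupp.sum w fun _ r => |r|⟩

theorem FinsuppL1.core : NormedSpace.Core ℝ (FinsuppL1 K) where
  norm_nonneg w := Finset.sum_nonneg fun _ _ => abs_nonneg _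
  norm_smul c w := by
    refine (Finsupp.sum_smul_index (g := (show K →₀ ℝ from w)) (b := c) (h := fun _ r => |r|)
      fun _ => abs_zero).trans ?_
    simp only [abs_mul]
    exact (Finsupp.mul_sum _ _).symm
  norm_triangle v w := by
    classical
    let v' : K →₀ ℝ := v
    let w' : K →₀ ℝ := w
    change (v' + w').sum (fun _ r => |r|) ≤ v'.sum (fun _ r => |r|) + w'.sum (fun _ r => |r|)
    rw [Finsupp.sum_of_support_subset (v' + w') Finsupp.support_add _ fun _ _ => abs_zero,
      Finsupp.sum_of_support_subset v' (Finset.subset_union_left (s₂ := w'.support)) _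
        fun _ _ => abs_zero,
      Finsupp.sum_of_support_subset w' (Finset.subset_union_right (s₁ := v'.support)) _
        fun _ _ => abs_zero, ← Finset.sum_add_distrib]
    exact Finset.sum_le_sum fun x _ => abs_add_le _ _
  norm_eq_zero_iff w := by
    constructor
    · intro h
      have h1 := (Finset.sum_eq_zero_iff_of_nonneg fun _ _ => abs_nonneg _).1 h
      refine Finsupp.ext fun x => ?_
      by_contra hx
      exact hx (abs_eq_zero.1 (h1 x (Finsupp.mem_support_iff.2 hx)))
    · rintro rfl
      exact Finsupp.sum_zero_index

noncomputable instance : NormedAddCommGroup (FinsuppL1 K) := .ofCore FinsuppL1.core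

noncomputable instance : NormedSpace ℝ (FinsuppL1 K) := .ofCore FinsuppL1.core

/-- The basis vectors of `FinsuppL1 K`. -/
noncomputable def FinsuppL1.basis (x : K) : FinsuppL1 K := Finsupp.single x 1

theorem FinsuppL1.norm_basis (x : K) : ‖FinsuppL1.basis x‖ = 1 :=
  (Finsupp.sum_single_index abs_zero).trans abs_one

/-- Identifies functionals with their coordinate functions, so equations in the dual can be checked
on basis vectors. -/
theorem FinsuppL1.dual_ext {f g : StrongDual ℝ (FinsuppL1 K)}
    (h : ∀ x, f (FinsuppL1.basis x) = g (FinsuppL1.basis x)) : f = g := by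
  have h1 : (f.toLinearMap : (K →₀ ℝ) →ₗ[ℝ] ℝ) = g.toLinearMap :=
    Finsupp.lhom_ext' fun x => LinearMap.ext_ring (h x)
  exact ContinuousLinearMap.ext fun w => congrArg (fun L : (K →₀ ℝ) →ₗ[ℝ] ℝ => L w) h1

theorem FinsuppL1.norm_linearCombination_le {c : K → ℝ} {C : ℝ} (hc : ∀ x, ‖c x‖ ≤ C)
    (w : K →₀ ℝ) : ‖Finsupp.linearCombination ℝ c w‖ ≤ C * w.sum fun _ r => |r| := by
  rw [Finsupp.linearCombination_apply, Finsupp.mul_sum]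
  refine (norm_sum_le _ _).trans (Finset.sum_le_sum fun x _ => ?_)
  rw [norm_smul, mul_comm]
  exact mul_le_mul_of_nonneg_right (hc x) (abs_nonneg _)

/-- The functional on `FinsuppL1 K` given by a bounded function. -/
noncomputable def FinsuppL1.functional (c : K → ℝ) (C : ℝ) (hc : ∀ x, ‖c x‖ ≤ C) :
    StrongDual ℝ (FinsuppL1 K) :=
  LinearMap.mkContinuous (Finsupp.linearCombination ℝ c : (K →₀ ℝ) →ₗ[ℝ] ℝ) C
    (FinsuppL1.norm_linearCombination_le hc)

theorem FinsuppL1.functional_basis (c : K → ℝ) (C : ℝ) (hc : ∀ x, ‖c x‖ ≤ C) (x : K) :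
    FinsuppL1.functional c C hc (FinsuppL1.basis x) = c x :=
  (Finsupp.linearCombination_single ℝ (1 : ℝ) x).trans (one_smul ℝ _)

theorem FinsuppL1.norm_functional_le (c : K → ℝ) {C : ℝ} (h0 : 0 ≤ C) (hc : ∀ x, ‖c x‖ ≤ C) :
    ‖FinsuppL1.functional c C hc‖ ≤ C :=
  LinearMap.mkContinuous_norm_le _ h0 _

variable [Group K]

variable (K) in
/-- The action of `K` on `FinsuppL1 K` by left translation. -/
noncomputable def FinsuppL1.action : K →* (FinsuppL1 K ≃ₗᵢ[ℝ] FinsuppL1 K) where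
  toFun k :=
    { toLinearEquiv := (Finsupp.domLCongr (Equiv.mulLeft k) : (K →₀ ℝ) ≃ₗ[ℝ] (K →₀ ℝ))
      norm_map' := fun w =>
        Finsupp.sum_equivMapDomain (Equiv.mulLeft k) (show K →₀ ℝ from w) fun _ r => |r| }
  map_one' := by
    refine LinearIsometryEquiv.ext fun w => Finsupp.ext fun x => ?_
    change (show K →₀ ℝ from w) (1⁻¹ * x) = (show K →₀ ℝ from w) x
    simp
  map_mul' k l := by
    refine LinearIsometryEquiv.ext fun w => Finsupp.ext fun x => ?_
    change (show K →₀ ℝ from w) ((k * l)⁻¹ * x) = (show K →₀ ℝ from w) (l⁻¹ * (k⁻¹ * x))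
    simp [mul_assoc]

theorem FinsuppL1.action_basis (k x : K) :
    FinsuppL1.action K k (FinsuppL1.basis x) = FinsuppL1.basis (k * x) :=
  Finsupp.equivMapDomain_single _ _ _

/-- An equivariant map into ℓ^∞(K) is determined by its coordinate at 1. That coordinate of α ∘ σ
extends the one of α without any equivariance, and translating it by K defines β; the norm bound
survives because ‖σ‖ ≤ 1 and K acts isometrically. -/
theorem FinsuppL1.isRelativelyInjective_dual :
    IsRelativelyInjective (dualAction (FinsuppL1.action K)) := by
  rintro A B _ _ _ _ ρA ρB ι α hι ⟨σ, hσ, hσι⟩ hα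
  have hb : ∀ (b : B) (x : K), ‖α (σ (ρB x⁻¹ b)) (FinsuppL1.basis 1)‖ ≤ ‖α‖ * ‖b‖ := by
    intro b x
    have h1 := (α (σ (ρB x⁻¹ b))).le_opNorm (FinsuppL1.basis 1)
    rw [FinsuppL1.norm_basis, mul_one] at h1
    refine h1.trans ((α.le_opNorm _).trans (mul_le_mul_of_nonneg_left ?_ (norm_nonneg _)))
    have h2 := σ.le_of_opNorm_le hσ (ρB x⁻¹ b)
    rwa [one_mul, LinearIsometryEquiv.norm_map] at h2
  let β : B →L[ℝ] StrongDual ℝ (FinsuppL1 K) := LinearMap.mkContinuous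
    { toFun := fun b => FinsuppL1.functional
        (fun x => α (σ (ρB x⁻¹ b)) (FinsuppL1.basis 1)) _ (hb b)
      map_add' := fun b b' => FinsuppL1.dual_ext fun x => by
        simp [FinsuppL1.functional_basis]
      map_smul' := fun c b => FinsuppL1.dual_ext fun x => by
        simp [FinsuppL1.functional_basis] } ‖α‖
    fun b => FinsuppL1.norm_functional_le _ (by positivity) (hb b)
  have hβ : ∀ b x, β b (FinsuppL1.basis x) = α (σ (ρB x⁻¹ b)) (FinsuppL1.basis 1) :=
    fun b x => FinsuppL1.functional_basis _ _ (hb b) x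
  refine ⟨β, fun k b => FinsuppL1.dual_ext fun x => ?_,
    ContinuousLinearMap.ext fun a => FinsuppL1.dual_ext fun x => ?_,
    LinearMap.mkContinuous_norm_le _ (norm_nonneg α) _⟩
  · rw [hβ, dualAction_apply, FinsuppL1.action_basis, hβ, mul_inv_rev, inv_inv, map_mul]
    rfl
  · have h1 : σ (ρB x⁻¹ (ι a)) = ρA x⁻¹ a := by
      rw [← hι]
      exact congrArg (fun L : A →L[ℝ] A => L (ρA x⁻¹ a)) hσι
    rw [ContinuousLinearMap.comp_apply, hβ, h1, hα, dualAction_apply, FinsuppL1.action_basis,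
      inv_inv, mul_one]

end SummableFunctions

/-! ### Shapiro-type descent to the subgroup. -/

/-- If the bounded cohomology of `Γ` with coefficients in the bounded functions on `Γ ⧸ H`
vanishes, then so does the bounded cohomology of `H` with real coefficients. -/
theorem subsingleton_Hb_subgroup {Γ : Type u} [Group Γ] (H : Subgroup Γ) [H.Normal] (n : ℕ)
    (h : Subsingleton (Hb ((dualAction (FinsuppL1.action (Γ ⧸ H))).comp (QuotientGroup.mk' H))
      (n + 1))) : Subsingleton (Hb (1 : H →* (ℝ ≃ₗᵢ[ℝ] ℝ)) (n + 1)) := by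
  rw [subsingleton_Hb_succ_iff_homogeneous] at h ⊢
  rintro F ⟨C, hC⟩ hF hδ
  obtain ⟨r, hr, hrH⟩ := exists_equivariant_retraction H
  have hR : ∀ h ∈ H, ∀ z, F (r ∘ (h • z)) = F (r ∘ z) := fun h hh z => by
    have h1 : r ∘ (h • z) = (⟨h, hh⟩ : H) • (r ∘ z) := funext fun i => hr ⟨h, hh⟩ (z i)
    rw [h1, hF]
    rfl
  -- The induced cocycle; coordinate x is r*F translated by a representative of x.
  let Φ : (Fin (n + 2) → Γ) → StrongDual ℝ (FinsuppL1 (Γ ⧸ H)) := fun z =>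
    FinsuppL1.functional (fun x => F (r ∘ (x.out⁻¹ • z))) C fun x => hC _
  have hΦ : ∀ z x, Φ z (FinsuppL1.basis x) = F (r ∘ (x.out⁻¹ • z)) := fun z x =>
    FinsuppL1.functional_basis _ _ _ x
  let ev : Γ ⧸ H → StrongDual ℝ (FinsuppL1 (Γ ⧸ H)) →ₗ[ℝ] ℝ := fun x =>
    { toFun := fun L => L (FinsuppL1.basis x)
      map_add' := fun _ _ => rfl
      map_smul' := fun _ _ => rfl }
  obtain ⟨G, ⟨D, hD⟩, hG, hGΦ⟩ := h Φ
    ⟨C, fun z => FinsuppL1.norm_functional_le _ ((norm_nonneg _).trans (hC (r ∘ z))) _⟩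
    (fun γ z => FinsuppL1.dual_ext fun x => by
      rw [MonoidHom.comp_apply, dualAction_apply, FinsuppL1.action_basis, hΦ, hΦ, smul_smul]
      refine apply_smul_eq_of_mk_eq (R := fun z => F (r ∘ z)) hR ?_ z
      simp)
    (funext fun z => FinsuppL1.dual_ext fun x => by
      refine (map_homDiff (ev x) (n + 2) Φ z).trans ?_
      change homDiff (n + 2) (fun w => Φ w (FinsuppL1.basis x)) z = 0
      simp only [hΦ]
      exact congrFun hδ (r ∘ (x.out⁻¹ • z)))
  -- H fixes 1 ∈ Γ ⧸ H, so this restriction is H-invariant.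
  refine ⟨fun z => G (Subtype.val ∘ z) (FinsuppL1.basis 1), ⟨D, fun z => ?_⟩, fun k z => ?_,
    funext fun z => ?_⟩
  · have h1 := (G (Subtype.val ∘ z)).le_opNorm (FinsuppL1.basis 1)
    rw [FinsuppL1.norm_basis, mul_one] at h1
    exact h1.trans (hD _)
  · have h1 : Subtype.val ∘ (k • z) = (k : Γ) • (Subtype.val ∘ z) := rfl
    have h2 : (QuotientGroup.mk' H) k = 1 := (QuotientGroup.eq_one_iff (k : Γ)).2 k.2
    change G (Subtype.val ∘ (k • z)) _ = G (Subtype.val ∘ z) _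
    rw [h1, hG, MonoidHom.comp_apply, h2, map_one]
    rfl
  · have h1 : homDiff (n + 1) (fun z : Fin (n + 1) → H =>
        G (Subtype.val ∘ z) (FinsuppL1.basis 1)) z =
        homDiff (n + 1) G (Subtype.val ∘ z) (FinsuppL1.basis 1) :=
      (map_homDiff (ev 1) (n + 1) G (Subtype.val ∘ z)).symm
    -- The chosen representative of 1 lies in H and so disappears by invariance of r*F; r is the
    -- identity on H, which returns F itself.
    have h2 : ((1 : Γ ⧸ H).out)⁻¹ ∈ H := by
      rw [← QuotientGroup.eq_one_iff, QuotientGroup.mk_inv, QuotientGroup.out_eq', inv_one]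
    have h3 : r ∘ Subtype.val ∘ z = z := funext fun i => hrH (z i)
    rw [h1, hGΦ, hΦ, hR _ h2, h3]

end BoundedCohomology

theorem mainTheorem5 (n : ℕ∞) (hn : 1 ≤ n) (Γ : Type u) [Group Γ]
    (hΓ : BoundedCohomology.BoundedlyAcyclic Γ n) (H : Subgroup Γ) [H.Normal] :
    BoundedCohomology.BoundedlyAcyclic H n ↔
      ∀ (W : Type u) [NormedAddCommGroup W] [NormedSpace ℝ W]
        (ρ : (Γ ⧸ H) →* (W ≃ₗᵢ[ℝ] W)),
        BoundedCohomology.IsRelativelyInjective (BoundedCohomology.dualAction ρ) →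
          ∀ i : ℕ, 1 ≤ i → (i : ℕ∞) ≤ n →
            Subsingleton (BoundedCohomology.Hb
              ((BoundedCohomology.dualAction ρ).comp (QuotientGroup.mk' H)) i) := by
  constructor
  · intro hH W _ _ ρ hρ i hi hin
    obtain ⟨m, rfl⟩ := Nat.exists_eq_add_of_le' hi
    refine BoundedCohomology.subsingleton_Hb_of_isRelativelyInjective H _ hρ m
      -- The linear choice of primitives is inductive, so acyclicity of H is used in all degrees
      -- from 1 to m + 1.
      (BoundedCohomology.subsingleton_Hb_strongDual m fun j hj =>
        hH (j + 1) (Nat.le_add_left 1 j) (le_trans ?_ hin))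
    exact_mod_cast Nat.succ_le_succ hj
  · intro h i hi hin
    obtain ⟨m, rfl⟩ := Nat.exists_eq_add_of_le' hi
    exact BoundedCohomology.subsingleton_Hb_subgroup H m
      (h _ _ BoundedCohomology.FinsuppL1.isRelativelyInjective_dual (m + 1) hi hin)
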